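/- Let $(M,\omega)$ be a compact, connected symplectic manifold with a Hamiltonian action of a compact torus $T$ and moment map $\Phi : M \to \mathfrak t^*$ (that is, $T$ acts smoothly on $M$ preserving $\omega$, $\Phi$ is smooth and $T$-invariant, and $d\langle \Phi,\xi\rangle = \omega(\xi_M,\cdot)$ for all $\xi\in\mathfrak t$, where $\xi_M$ is the vector field on $M$ generated by $\xi$). Let $\sigma : M\to M$ be an anti-symplectic involution, i.e. a smooth map with $\sigma\circ\sigma=\mathrm{id}$ and $\sigma^*\omega=-\omega$, which anti-commutes with the action: $\sigma(t\cdot x)=t^{-1}\cdot\sigma(x)$ for all $t\in T$, $x\in M$. Let $\mu\in\mathfrak t^*$ be a regular value of $\Phi$ such that $T$ acts freely on $\Phi^{-1}(\mu)$. Let $i:\Phi^{-1}(\mu)\hookrightarrow M$ be the inclusion of the level set, regarded as an embedded submanifold of $M$; let $M/\!/T(\mu)=\Phi^{-1}(\mu)/T$ be the symplectic reduction, with the smooth structure for which the quotient map $\pi:\Phi^{-1}(\mu)\to M/\!/T(\mu)$ is a submersion; and let $\omega_{red}$ be the reduced form on $M/\!/T(\mu)$, characterized by $\pi^*\omega_{red}=i^*\omega$.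 Then $\Phi\circ\sigma=\Phi$, so that $\sigma$ induces a map $\sigma_{red}:M/\!/T(\mu)\to M/\!/T(\mu)$ with $\sigma_{red}(\pi(z))=\pi(\sigma(z))$ for all $z \in \Phi^{-1}(\mu)$, and $\sigma_{red}$ is an anti-symplectic involution with respect to $\omega_{red}$: it is smooth, $\sigma_{red}\circ\sigma_{red}=\mathrm{id}$, and $\sigma_{red}^*\omega_{red}=-\omega_{red}$. -/

import Mathlib

open scoped Manifold ContDiff

noncomputable section

namespace RealReduction

/-! ### Differential two-forms on manifolds -/

section TwoForms

variable {E : Type*} [NormedAddCommGroup E] [NormedSpace ℝ E]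
  {M : Type*} [TopologicalSpace M] [ChartedSpace E M]
  {E' : Type*} [NormedAddCommGroup E'] [NormedSpace ℝ E']
  {N : Type*} [TopologicalSpace N] [ChartedSpace E' N]

variable (E M) in
/-- A (not necessarily smooth) differential two-form on a manifold `M` modelled on `E`: an
alternating bilinear form on every tangent space. -/
abbrev TwoForm : Type _ := ∀ x : M, TangentSpace 𝓘(ℝ, E) x [⋀^Fin 2]→L[ℝ] ℝ

/-- The pullback `f^* Ω`, given by `(f^* Ω)_x(u, v) = Ω_{f x}(df_x u, df_x v)`. -/
def pullback (f : N → M) (Ω : TwoForm E M) : TwoForm E' N :=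
  fun x => (Ω (f x)).compContinuousLinearMap (mfderiv 𝓘(ℝ, E') 𝓘(ℝ, E) f x)

/-- The expression of `Ω` in the preferred chart `φ` at `x₀`: the two-form `(φ⁻¹)^* Ω`, which is
meaningful on the open subset `(extChartAt 𝓘(ℝ, E) x₀).target` of `E`. -/
def inChart (Ω : TwoForm E M) (x₀ : M) : E → E [⋀^Fin 2]→L[ℝ] ℝ :=
  pullback (E' := E) (N := E) (extChartAt 𝓘(ℝ, E) x₀).symm Ω

/-- A symplectic form: a smooth, closed, nondegenerate two-form. Smoothness and closedness are
expressed in charts. -/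
structure IsSymplecticForm (Ω : TwoForm E M) : Prop where
  smooth : ∀ x₀ : M, ContDiffOn ℝ ∞ (inChart Ω x₀) (extChartAt 𝓘(ℝ, E) x₀).target
  closed : ∀ x₀ : M, ∀ y ∈ (extChartAt 𝓘(ℝ, E) x₀).target, extDeriv (inChart Ω x₀) y = 0
  nondegenerate : ∀ (x : M) (u : TangentSpace 𝓘(ℝ, E) x), (∀ v, Ω x ![u, v] = 0) → u = 0

/-- `σ` is an anti-symplectic involution of `M` with respect to `Ω`: a smooth map with
`σ ∘ σ = id` and `σ^* Ω = -Ω`. -/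
structure IsAntisymplecticInvolution (Ω : TwoForm E M) (σ : M → M) : Prop where
  smooth : ContMDiff 𝓘(ℝ, E) 𝓘(ℝ, E) ∞ σ
  involutive : Function.Involutive σ
  pullback_eq : pullback σ Ω = -Ω

end TwoForms

/-! ### Hamiltonian actions and symplectic reduction -/

section Hamiltonian

/-- The dual `𝔱^*` of the Lie algebra `𝔱 = T_1 T` of a Lie group `T` modelled on `F`. As a vector
space, the tangent space `𝔱 = GroupLieAlgebra 𝓘(ℝ, F) T` is `F` by definition; writing `F` here
makes the norm available. -/
abbrev LieDual (F : Type*) [NormedAddCommGroup F] [NormedSpace ℝ F] : Type _ := F →L[ℝ] ℝ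

variable {F : Type*} [NormedAddCommGroup F] [NormedSpace ℝ F]
  {T : Type*} [TopologicalSpace T] [ChartedSpace F T] [CommGroup T]
  {E : Type*} [NormedAddCommGroup E] [NormedSpace ℝ E]
  {M : Type*} [TopologicalSpace M] [ChartedSpace E M] [MulAction T M]

variable (E) in
/-- The vector field on `M` generated by `ξ ∈ 𝔱`: its value at `x` is the derivative of
`t ↦ t • x` at `t = 1` in the direction `ξ`. -/
def fundamentalField (ξ : GroupLieAlgebra 𝓘(ℝ, F) T) (x : M) : TangentSpace 𝓘(ℝ, E) x :=
  (mfderiv 𝓘(ℝ, F) 𝓘(ℝ, E) (fun t : T => t • x) 1 ξ : TangentSpace 𝓘(ℝ, E) ((1 : T) • x))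

variable (T) in
/-- The (smooth) action of the torus `T` on the symplectic manifold `(M, Ω)` is Hamiltonian with
moment map `Φ : M → 𝔱^*`: the action preserves `Ω`, and `Φ` is a smooth `T`-invariant map with
`d⟨Φ, ξ⟩ = Ω(ξ_M, ·)` for all `ξ ∈ 𝔱`. -/
structure IsHamiltonianWith (Ω : TwoForm E M) (Φ : M → LieDual F) : Prop where
  preserves : ∀ t : T, pullback (fun x : M => t • x) Ω = Ω
  smooth : ContMDiff 𝓘(ℝ, E) 𝓘(ℝ, LieDual F) ∞ Φ
  invariant : ∀ (t : T) (x : M), Φ (t • x) = Φ x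
  moment : ∀ (ξ : GroupLieAlgebra 𝓘(ℝ, F) T) (x : M) (v : TangentSpace 𝓘(ℝ, E) x),
    mfderiv 𝓘(ℝ, E) 𝓘(ℝ, ℝ) (fun y => Φ y ξ) x v = Ω x ![fundamentalField E ξ x, v]

/-- `σ` anti-commutes with the action of `T`. -/
def AntiCommutes (T : Type*) [CommGroup T] {M : Type*} [MulAction T M] (σ : M → M) : Prop :=
  ∀ (t : T) (x : M), σ (t • x) = t⁻¹ • σ x

variable (E) in
/-- `μ` is a regular value of `Φ`. -/
def IsRegularValue (Φ : M → LieDual F) (μ : LieDual F) : Prop :=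
  ∀ x : M, Φ x = μ → Function.Surjective (mfderiv 𝓘(ℝ, E) 𝓘(ℝ, LieDual F) Φ x)

/-- The level set `Φ⁻¹(μ)`, with the subspace topology. -/
abbrev LevelSet (Φ : M → LieDual F) (μ : LieDual F) : Type _ := {x : M // Φ x = μ}

variable (T) in
/-- Two points of `Φ⁻¹(μ)` are equivalent if they lie in the same `T`-orbit. -/
abbrev levelSetoid (Φ : M → LieDual F) (μ : LieDual F) : Setoid (LevelSet Φ μ) :=
  (MulAction.orbitRel T M).comap Subtype.val

variable (T) in
/-- The symplectic reduction `M//T(μ) = Φ⁻¹(μ)/T`, with the quotient topology. -/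
def Reduction (Φ : M → LieDual F) (μ : LieDual F) : Type _ := Quotient (levelSetoid T Φ μ)

instance (Φ : M → LieDual F) (μ : LieDual F) : TopologicalSpace (Reduction T Φ μ) :=
  inferInstanceAs (TopologicalSpace (Quotient (levelSetoid T Φ μ)))

/-- The inclusion `i : Φ⁻¹(μ) → M`. -/
def incl (Φ : M → LieDual F) (μ : LieDual F) : LevelSet Φ μ → M := Subtype.val

variable (T) in
/-- The quotient map `π : Φ⁻¹(μ) → M//T(μ)`. -/
def proj (Φ : M → LieDual F) (μ : LieDual F) : LevelSet Φ μ → Reduction T Φ μ :=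
  Quotient.mk (levelSetoid T Φ μ)

/-- The map `σ_red` that a map `σ`, anti-commuting with `T` and leaving `Φ` invariant, induces on
`M//T(μ)`; it is given by `σ_red (π z) = π (σ z)`. -/
def inducedMap {σ : M → M} (hσ : AntiCommutes T σ) {Φ : M → LieDual F}
    (hΦ : ∀ x, Φ (σ x) = Φ x) (μ : LieDual F) : Reduction T Φ μ → Reduction T Φ μ :=
  Quotient.map (fun z : LevelSet Φ μ => (⟨σ z.1, (hΦ z.1).trans z.2⟩ : LevelSet Φ μ)) (by
    rintro ⟨x, hx⟩ ⟨y, hy⟩ ⟨t, ht⟩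
    refine ⟨t⁻¹, ?_⟩
    have ht' : t • y = x := ht
    change t⁻¹ • σ y = σ x
    rw [← hσ, ht'])

end Hamiltonian

end RealReduction

end

/-! Differentiating `σ (t • x) = t⁻¹ • σ x` at `t = 1` shows that `σ` sends each fundamental field
`ξ_M` to `-ξ_M`, while `σ^* Ω = -Ω`. In the moment equation the two signs cancel, so `Φ ∘ σ` and `Φ`
have the same differential and differ by a constant on the connected manifold `M`. Exchanging `x`
and `σ x` changes the sign of that constant, so it is zero (`momentMap_invariant`).

Hence `σ` restricts to the level set and descends to the quotient. Everything about `σ_red` is then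
checked after composing with `π`. Since a surjective submersion has smooth local sections,
smoothness of `σ_red ∘ π` gives smoothness of `σ_red` (`contMDiff_of_comp_isSubmersion`). Since `dπ`
is onto, two forms with equal pullbacks under `π` are equal (`pullback_injective_of_isSubmersion`),
and `π^* Ωred = i^* Ω` moves the sign computation up to `M`. -/

namespace RealReduction

open Set Filter Topology Manifold

/-! ### Submersions between manifolds without boundary -/

section Submersion

variable {𝕜 : Type*} [NontriviallyNormedField 𝕜]
  {E : Type*} [NormedAddCommGroup E] [NormedSpace 𝕜 E]
  {E' : Type*} [NormedAddCommGroup E'] [NormedSpace 𝕜 E']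
  {E'' : Type*} [NormedAddCommGroup E''] [NormedSpace 𝕜 E'']
  {M : Type*} [TopologicalSpace M] [ChartedSpace E M]
  {N : Type*} [TopologicalSpace N] [ChartedSpace E' N]
  {P : Type*} [TopologicalSpace P] [ChartedSpace E'' P]
  {n : WithTop ℕ∞} {f : M → N} {x : M}

/-- A submersion has a `C^n` local section through every point. -/
theorem exists_local_section_of_isSubmersionAt [IsManifold 𝓘(𝕜, E) n M] [IsManifold 𝓘(𝕜, E') n N]
    (h : IsSubmersionAt 𝓘(𝕜, E) 𝓘(𝕜, E') n f x) :
    ∃ s : N → M, s (f x) = x ∧ ContMDiffAt 𝓘(𝕜, E') 𝓘(𝕜, E) n s (f x) ∧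
      ∀ᶠ y in 𝓝 (f x), f (s y) = y := by
  set d := h.domChart
  set c := h.codChart
  set e := h.equiv
  have hxd : x ∈ d.source := h.mem_domChart_source
  have hxc : f x ∈ c.source := h.mem_codChart_source
  -- Local normal form of a submersion: after the splitting `e`, it is the first projection.
  have hw : ∀ u ∈ d.target, c (f (d.symm u)) = (e u).1 := fun u hu => by
    have hu' : u ∈ (h.domChart.extend 𝓘(𝕜, E)).target := by simpa using hu
    simpa using h.writtenInCharts hu'
  -- Freezing the complementary coordinate at its value at `x` makes the section pass through `x`.
  let k : N → E := fun y => e.symm (c y, (e (d x)).2)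
  have hkx : k (f x) = d x := by
    have h1 : c (f x) = (e (d x)).1 := by
      have := hw (d x) (d.map_source hxd)
      rwa [d.left_inv hxd] at this
    simp [k, h1]
  have hk : ContMDiffAt 𝓘(𝕜, E') 𝓘(𝕜, E) n k (f x) := by
    have hc : ContMDiffAt 𝓘(𝕜, E') 𝓘(𝕜, E') n c (f x) :=
      (contMDiffOn_of_mem_maximalAtlas h.codChart_mem_maximalAtlas).contMDiffAt
        (c.open_source.mem_nhds hxc)
    have hp : ContMDiffAt 𝓘(𝕜, E') 𝓘(𝕜, E' × h.complement) n
        (fun y => (c y, (e (d x)).2)) (f x) := hc.prodMk_space contMDiffAt_const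
    exact e.symm.toContinuousLinearMap.contMDiff.contMDiffAt.comp (f x) hp
  have hdsymm : ContMDiffAt 𝓘(𝕜, E) 𝓘(𝕜, E) n d.symm (k (f x)) :=
    (contMDiffOn_symm_of_mem_maximalAtlas h.domChart_mem_maximalAtlas).contMDiffAt
      (d.open_target.mem_nhds (hkx ▸ d.map_source hxd))
  refine ⟨fun y => d.symm (k y), by simp only [hkx, d.left_inv hxd], hdsymm.comp (f x) hk, ?_⟩
  have ht : ∀ᶠ y in 𝓝 (f x), k y ∈ d.target :=
    hk.continuousAt.eventually (d.open_target.mem_nhds (hkx ▸ d.map_source hxd))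
  filter_upwards [ht, c.open_source.mem_nhds hxc] with y hy hyc
  refine c.injOn (h.source_subset_preimage_source (d.map_target hy)) hyc ?_
  rw [hw _ hy]
  simp [k]

/-- A submersion has surjective differential. -/
theorem mfderiv_surjective_of_isSubmersionAt [IsManifold 𝓘(𝕜, E) n M] [IsManifold 𝓘(𝕜, E') n N]
    (hn : n ≠ 0) (h : IsSubmersionAt 𝓘(𝕜, E) 𝓘(𝕜, E') n f x) :
    Function.Surjective (mfderiv 𝓘(𝕜, E) 𝓘(𝕜, E') f x) := by
  obtain ⟨s, hsx, hs, hfs⟩ := exists_local_section_of_isSubmersionAt h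
  have hf : HasMFDerivAt 𝓘(𝕜, E) 𝓘(𝕜, E') f (s (f x)) (mfderiv 𝓘(𝕜, E) 𝓘(𝕜, E') f (s (f x))) :=
    (hsx.symm ▸ h.contMDiffAt.mdifferentiableAt hn :
      MDifferentiableAt 𝓘(𝕜, E) 𝓘(𝕜, E') f (s (f x))).hasMFDerivAt
  have hcomp := hf.comp (f x) (hs.mdifferentiableAt hn).hasMFDerivAt
  have hid := (hasMFDerivAt_id (I := 𝓘(𝕜, E')) (f x)).congr_of_eventuallyEq
    (f₁ := f ∘ s) (by filter_upwards [hfs] with y hy using hy)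
  have heq := hasMFDerivAt_unique hcomp hid
  -- By the chain rule for `f ∘ s = id`, the differential of the section is a right inverse of that
  -- of `f`.
  have hsurj : Function.Surjective (mfderiv 𝓘(𝕜, E) 𝓘(𝕜, E') f (s (f x))) := fun v =>
    ⟨_, DFunLike.congr_fun heq v⟩
  rwa [hsx] at hsurj

/-- A map is `C^n` as soon as its composition with a surjective submersion is. -/
theorem contMDiff_of_comp_isSubmersion [IsManifold 𝓘(𝕜, E) n M] [IsManifold 𝓘(𝕜, E') n N]
    (hf : IsSubmersion 𝓘(𝕜, E) 𝓘(𝕜, E') n f) (hsurj : Function.Surjective f) {g : N → P}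
    (hg : ContMDiff 𝓘(𝕜, E) 𝓘(𝕜, E'') n (g ∘ f)) : ContMDiff 𝓘(𝕜, E') 𝓘(𝕜, E'') n g := by
  intro y
  obtain ⟨x, rfl⟩ := hsurj y
  obtain ⟨s, -, hs, hfs⟩ := exists_local_section_of_isSubmersionAt (hf.isSubmersionAt x)
  -- Near `f x`, `g` agrees with `(g ∘ f) ∘ s`.
  refine ((hg (s (f x))).comp (f x) hs).congr_of_eventuallyEq ?_
  filter_upwards [hfs] with y hy
  simp [hy]

end Submersion

/-! ### Functions with zero differential -/

section Constant

variable {E : Type*} [NormedAddCommGroup E] [NormedSpace ℝ E]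
  {G : Type*} [NormedAddCommGroup G] [NormedSpace ℝ G]
  {M : Type*} [TopologicalSpace M] [ChartedSpace E M] [IsManifold 𝓘(ℝ, E) 1 M]

/-- A function on a manifold without boundary with zero differential is locally constant. -/
theorem isLocallyConstant_of_mfderiv_eq_zero {g : M → G}
    (hg : MDifferentiable 𝓘(ℝ, E) 𝓘(ℝ, G) g) (h0 : ∀ x, mfderiv 𝓘(ℝ, E) 𝓘(ℝ, G) g x = 0) :
    IsLocallyConstant g := by
  rw [IsLocallyConstant.iff_eventually_eq]
  intro x
  set c := chartAt E x
  have hderiv : ∀ u ∈ c.target, HasFDerivAt (g ∘ c.symm) (0 : E →L[ℝ] G) u := by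
    intro u hu
    have h1 : MDifferentiableAt 𝓘(ℝ, E) 𝓘(ℝ, E) c.symm u :=
      mdifferentiableAt_atlas_symm (chart_mem_atlas E x) hu
    have h2 := (hg (c.symm u)).hasMFDerivAt.comp u h1.hasMFDerivAt
    rw [h0, ContinuousLinearMap.zero_comp] at h2
    exact h2.hasFDerivAt
  have hcx : c x ∈ c.target := c.map_source (mem_chart_source E x)
  obtain ⟨r, hr, hball⟩ := Metric.isOpen_iff.1 c.open_target _ hcx
  have hc : ∀ᶠ y in 𝓝 x, c y ∈ Metric.ball (c x) r :=
    (c.continuousAt (mem_chart_source E x)).eventually (Metric.ball_mem_nhds _ hr)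
  filter_upwards [hc, c.open_source.mem_nhds (mem_chart_source E x)] with y hy hys
  have := Metric.isOpen_ball.is_const_of_fderiv_eq_zero (𝕜 := ℝ) (f := g ∘ c.symm)
    (convex_ball (c x) r).isPreconnected
    (fun u hu => (hderiv u (hball hu)).differentiableAt.differentiableWithinAt)
    (fun u hu => (hderiv u (hball hu)).fderiv) hy (Metric.mem_ball_self hr)
  simpa [c.left_inv hys, c.left_inv (mem_chart_source E x)] using this

end Constant

/-! ### The differential of inversion, and maps anti-commuting with the action -/

section Fundamental

variable {F : Type*} [NormedAddCommGroup F] [NormedSpace ℝ F]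
  {T : Type*} [TopologicalSpace T] [ChartedSpace F T] [CommGroup T]
  {E : Type*} [NormedAddCommGroup E] [NormedSpace ℝ E]
  {M : Type*} [TopologicalSpace M] [ChartedSpace E M]

variable (F T) in
/-- The differential of `t ↦ t⁻¹` at the identity is `-id`. -/
theorem hasMFDerivAt_inv_one [LieGroup 𝓘(ℝ, F) ∞ T] :
    HasMFDerivAt 𝓘(ℝ, F) 𝓘(ℝ, F) (fun t : T => t⁻¹) 1
      (-ContinuousLinearMap.id ℝ F : F →L[ℝ] F) := by
  have hmul : MDifferentiable (𝓘(ℝ, F).prod 𝓘(ℝ, F)) 𝓘(ℝ, F) (fun p : T × T => p.1 * p.2) :=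
    (contMDiff_mul 𝓘(ℝ, F) ∞).mdifferentiable (by simp)
  have hinv : MDifferentiableAt 𝓘(ℝ, F) 𝓘(ℝ, F) (fun t : T => t⁻¹) 1 :=
    (contMDiff_inv 𝓘(ℝ, F) ∞).mdifferentiable (by simp) 1
  let L : F →L[ℝ] F := mfderiv 𝓘(ℝ, F) 𝓘(ℝ, F) (fun t : T => t⁻¹) 1
  have hL : HasMFDerivAt 𝓘(ℝ, F) 𝓘(ℝ, F) (fun t : T => t⁻¹) 1 L := hinv.hasMFDerivAt
  -- The base point is `(1, 1⁻¹)`, the value of `t ↦ (t, t⁻¹)` at `1`. Differentiating `t * t⁻¹ =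
  -- 1`, `t * 1⁻¹ = t` and `1 * t = t` gives `D (v, L v) = 0`, `D (v, 0) = v` and `D (0, w) = w`,
  -- whence `v + L v = 0`.
  let D : F × F →L[ℝ] F :=
    mfderiv (𝓘(ℝ, F).prod 𝓘(ℝ, F)) 𝓘(ℝ, F) (fun p : T × T => p.1 * p.2) ((1 : T), (1 : T)⁻¹)
  have hD : HasMFDerivAt (𝓘(ℝ, F).prod 𝓘(ℝ, F)) 𝓘(ℝ, F) (fun p : T × T => p.1 * p.2)
      ((1 : T), (1 : T)⁻¹) D := (hmul _).hasMFDerivAt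
  have hboth : D ∘L (ContinuousLinearMap.id ℝ F).prod L = 0 := by
    have h := hD.comp (1 : T) ((hasMFDerivAt_id (I := 𝓘(ℝ, F)) (1 : T)).prodMk hL)
    have h' := hasMFDerivAt_const (I := 𝓘(ℝ, F)) (I' := 𝓘(ℝ, F)) (1 : T) (1 : T)
    refine hasMFDerivAt_unique h (h'.congr_of_eventuallyEq (.of_forall fun t => ?_))
    simp
  have hfst : D ∘L (ContinuousLinearMap.id ℝ F).prod 0 = ContinuousLinearMap.id ℝ F := by
    have h := hD.comp (1 : T) ((hasMFDerivAt_id (I := 𝓘(ℝ, F)) (1 : T)).prodMk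
      (hasMFDerivAt_const (I := 𝓘(ℝ, F)) (I' := 𝓘(ℝ, F)) (1 : T)⁻¹ (1 : T)))
    have h' := hasMFDerivAt_id (I := 𝓘(ℝ, F)) (1 : T)
    refine hasMFDerivAt_unique h (h'.congr_of_eventuallyEq (.of_forall fun t => ?_))
    simp
  have hsnd : D ∘L (0 : F →L[ℝ] F).prod (ContinuousLinearMap.id ℝ F) =
      ContinuousLinearMap.id ℝ F := by
    have h := hD.comp (1 : T)⁻¹ ((hasMFDerivAt_const (I := 𝓘(ℝ, F)) (I' := 𝓘(ℝ, F)) (1 : T)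
      (1 : T)⁻¹).prodMk (hasMFDerivAt_id (I := 𝓘(ℝ, F)) (1 : T)⁻¹))
    have h' := hasMFDerivAt_id (I := 𝓘(ℝ, F)) (1 : T)⁻¹
    refine hasMFDerivAt_unique h (h'.congr_of_eventuallyEq (.of_forall fun t => ?_))
    simp
  have hLneg : L = -ContinuousLinearMap.id ℝ F := by
    ext v
    have h1 : D (v, L v) = 0 := DFunLike.congr_fun hboth v
    have h2 : D (v, 0) = v := DFunLike.congr_fun hfst v
    have h3 : D (0, L v) = L v := DFunLike.congr_fun hsnd (L v)
    have h4 : D (v, 0) + D (0, L v) = D (v, L v) := by rw [← map_add]; simp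
    rw [h1, h2, h3] at h4
    exact (neg_eq_of_add_eq_zero_right h4).symm
  exact hLneg ▸ hL

variable [MulAction T M] [ContMDiffSMul 𝓘(ℝ, F) 𝓘(ℝ, E) ∞ T M]

variable (F T E) in
theorem mdifferentiable_smul_const (x : M) :
    MDifferentiable 𝓘(ℝ, F) 𝓘(ℝ, E) (fun t : T => t • x) :=
  ((contMDiff_id.smul contMDiff_const :
    ContMDiff 𝓘(ℝ, F) 𝓘(ℝ, E) ∞ (fun t : T => t • x))).mdifferentiable (by simp)

/-- A map anti-commuting with the action reverses the fundamental vector fields. -/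
theorem mfderiv_fundamentalField [LieGroup 𝓘(ℝ, F) ∞ T] {σ : M → M}
    (hσ : MDifferentiable 𝓘(ℝ, E) 𝓘(ℝ, E) σ)
    (hσT : AntiCommutes T σ) (ξ : GroupLieAlgebra 𝓘(ℝ, F) T) (x : M) :
    mfderiv 𝓘(ℝ, E) 𝓘(ℝ, E) σ x (fundamentalField E ξ x) = -fundamentalField E ξ (σ x) := by
  let S : E →L[ℝ] E := mfderiv 𝓘(ℝ, E) 𝓘(ℝ, E) σ x
  let A : F →L[ℝ] E := mfderiv 𝓘(ℝ, F) 𝓘(ℝ, E) (fun t : T => t • x) 1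
  let B : F →L[ℝ] E := mfderiv 𝓘(ℝ, F) 𝓘(ℝ, E) (fun t : T => t • σ x) 1
  have hA : HasMFDerivAt 𝓘(ℝ, F) 𝓘(ℝ, E) (fun t : T => t • x) 1 A :=
    (mdifferentiable_smul_const F T E x 1).hasMFDerivAt
  -- The chain rule needs derivatives at `1 • x` and `1⁻¹`, which equal `x` and `1` only
  -- propositionally; hence the free base points here and in `hB`.
  have hS : ∀ y, y = x → HasMFDerivAt 𝓘(ℝ, E) 𝓘(ℝ, E) σ y S := by
    rintro y rfl
    exact (hσ y).hasMFDerivAt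
  have hB : ∀ t : T, t = 1 → HasMFDerivAt 𝓘(ℝ, F) 𝓘(ℝ, E) (fun t : T => t • σ x) t B := by
    rintro t rfl
    exact (mdifferentiable_smul_const F T E (σ x) 1).hasMFDerivAt
  have h1 := (hS ((1 : T) • x) (one_smul T x)).comp (1 : T) hA
  have h2 := (hB (1 : T)⁻¹ inv_one).comp (1 : T) (hasMFDerivAt_inv_one F T)
  have heq : S ∘L A = B ∘L (-ContinuousLinearMap.id ℝ F) :=
    hasMFDerivAt_unique h1 (h2.congr_of_eventuallyEq (.of_forall fun t => hσT t x))
  have h3 : S (A ξ) = B (-ξ) := DFunLike.congr_fun heq ξ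
  exact h3.trans (map_neg B ξ)

end Fundamental

/-! ### Invariance of the moment map -/

section Moment

variable {F : Type*} [NormedAddCommGroup F] [NormedSpace ℝ F]
  {T : Type*} [TopologicalSpace T] [ChartedSpace F T] [CommGroup T] [LieGroup 𝓘(ℝ, F) ∞ T]
  {E : Type*} [NormedAddCommGroup E] [NormedSpace ℝ E]
  {M : Type*} [TopologicalSpace M] [ChartedSpace E M]
  [MulAction T M] [ContMDiffSMul 𝓘(ℝ, F) 𝓘(ℝ, E) ∞ T M]
  {Ω : TwoForm E M} {Φ : M → LieDual F} {σ : M → M}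

theorem IsAntisymplecticInvolution.apply_mfderiv {Ω : TwoForm E M} {σ : M → M}
    (hσ : IsAntisymplecticInvolution Ω σ) (x : M) (u v : TangentSpace 𝓘(ℝ, E) x) :
    Ω (σ x) ![mfderiv 𝓘(ℝ, E) 𝓘(ℝ, E) σ x u, mfderiv 𝓘(ℝ, E) 𝓘(ℝ, E) σ x v] = -Ω x ![u, v] := by
  have h := DFunLike.congr_fun (congrFun hσ.pullback_eq x) ![u, v]
  have h2 : (⇑(mfderiv 𝓘(ℝ, E) 𝓘(ℝ, E) σ x) ∘ ![u, v]) =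
      ![mfderiv 𝓘(ℝ, E) 𝓘(ℝ, E) σ x u, mfderiv 𝓘(ℝ, E) 𝓘(ℝ, E) σ x v] := by
    ext i; fin_cases i <;> rfl
  rw [← h2]
  exact h

/-- The moment map is invariant under an anti-symplectic involution anti-commuting with the
action, if the manifold is connected. -/
theorem momentMap_invariant [IsManifold 𝓘(ℝ, E) ∞ M] [PreconnectedSpace M] (hΦ : IsHamiltonianWith T Ω Φ)
    (hσ : IsAntisymplecticInvolution Ω σ) (hσT : AntiCommutes T σ) (x : M) : Φ (σ x) = Φ x := by
  have : IsManifold 𝓘(ℝ, E) 1 M := .of_le (n := ∞) (by simp)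
  ext ξ
  have hσd : MDifferentiable 𝓘(ℝ, E) 𝓘(ℝ, E) σ := hσ.smooth.mdifferentiable (by simp)
  have hf : MDifferentiable 𝓘(ℝ, E) 𝓘(ℝ, ℝ) (fun y => Φ y ξ) :=
    (((ContinuousLinearMap.apply ℝ ℝ ξ).contMDiff (n := ∞)).comp hΦ.smooth).mdifferentiable
      (by simp)
  have hcomp : ∀ y, HasMFDerivAt 𝓘(ℝ, E) 𝓘(ℝ, ℝ) (fun y => Φ (σ y) ξ) y
      (mfderiv 𝓘(ℝ, E) 𝓘(ℝ, ℝ) (fun y => Φ y ξ) y) := by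
    intro y
    have h := (hf (σ y)).hasMFDerivAt.comp y (hσd y).hasMFDerivAt
    have heq : (mfderiv 𝓘(ℝ, E) 𝓘(ℝ, ℝ) (fun y => Φ y ξ) (σ y) : E →L[ℝ] ℝ) ∘L
        (mfderiv 𝓘(ℝ, E) 𝓘(ℝ, E) σ y : E →L[ℝ] E) =
        (mfderiv 𝓘(ℝ, E) 𝓘(ℝ, ℝ) (fun y => Φ y ξ) y : E →L[ℝ] ℝ) := by
      ext v
      refine (hΦ.moment ξ (σ y) _).trans (Eq.trans ?_ (hΦ.moment ξ y v).symm)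
      have h1 := hσ.apply_mfderiv y (fundamentalField E (T := T) ξ y) v
      have h3 := mfderiv_fundamentalField hσd hσT (ξ : GroupLieAlgebra 𝓘(ℝ, F) T) y
      have h2 : ∀ a b : TangentSpace 𝓘(ℝ, E) (σ y), Ω (σ y) ![-a, b] = -Ω (σ y) ![a, b] := by
        intro a b
        have he : ∀ c : TangentSpace 𝓘(ℝ, E) (σ y), Function.update ![a, b] 0 c = ![c, b] :=
          fun c => by ext i; fin_cases i <;> rfl
        simpa [he] using (Ω (σ y)).map_update_smul ![a, b] 0 (-1 : ℝ) a
      -- `-Ω(ξ_M, dσ v) = Ω(dσ ξ_M, dσ v) = -Ω(ξ_M, v)`, the first two at `σ y` and the last at `y`.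
      exact neg_injective ((h2 _ _).symm.trans
        ((congrArg (fun a => Ω (σ y) ![a, mfderiv 𝓘(ℝ, E) 𝓘(ℝ, E) σ y v]) h3).symm.trans h1))
    exact heq ▸ h
  have hloc := isLocallyConstant_of_mfderiv_eq_zero (E := E)
    (g := fun y => Φ (σ y) ξ - Φ y ξ)
    (fun y => ((hcomp y).sub (hf y).hasMFDerivAt).mdifferentiableAt)
    (fun y => ((hcomp y).sub (hf y).hasMFDerivAt).mfderiv.trans (sub_self _))
  -- The difference `Φ ∘ σ - Φ` is constant, yet its values at `σ x` and `x` are opposite.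
  have := hloc.apply_eq_of_preconnectedSpace (σ x) x
  simp only [hσ.involutive x] at this
  linarith

end Moment

/-! ### The induced involution on the reduction -/

section Reduction

variable {F : Type*} [NormedAddCommGroup F] [NormedSpace ℝ F]
  {T : Type*} [CommGroup T]
  {E : Type*} [NormedAddCommGroup E] [NormedSpace ℝ E]
  {M : Type*} [TopologicalSpace M] [ChartedSpace E M]
  [MulAction T M] {Ω : TwoForm E M} {Φ : M → LieDual F} {σ : M → M} {μ : LieDual F}
  {EZ : Type*} [NormedAddCommGroup EZ] [NormedSpace ℝ EZ]
  [ChartedSpace EZ (LevelSet Φ μ)]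
  {ER : Type*} [NormedAddCommGroup ER] [NormedSpace ℝ ER]
  [ChartedSpace ER (Reduction T Φ μ)]

/-- The restriction of `σ` to the level set `Φ⁻¹(μ)`. -/
def levelMap (hinv : ∀ x, Φ (σ x) = Φ x) (μ : LieDual F) (z : LevelSet Φ μ) : LevelSet Φ μ :=
  ⟨σ z.1, (hinv z.1).trans z.2⟩

/-- A continuous map into an immersed manifold is smooth once its composite with the immersion is;
the subspace topology supplies continuity. -/
theorem contMDiff_levelMap (hincl : IsSmoothEmbedding 𝓘(ℝ, EZ) 𝓘(ℝ, E) ∞ (incl Φ μ))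
    (hσ : ContMDiff 𝓘(ℝ, E) 𝓘(ℝ, E) ∞ σ) (hinv : ∀ x, Φ (σ x) = Φ x) :
    ContMDiff 𝓘(ℝ, EZ) 𝓘(ℝ, EZ) ∞ (levelMap hinv μ) := by
  rw [ContMDiff.iff_comp_isImmersion hincl.isImmersion]
  exact ⟨(hσ.continuous.comp continuous_subtype_val).subtype_mk _, hσ.comp hincl.contMDiff⟩

theorem pullback_comp_apply {E₁ E₂ E₃ : Type*} [NormedAddCommGroup E₁] [NormedSpace ℝ E₁]
    [NormedAddCommGroup E₂] [NormedSpace ℝ E₂] [NormedAddCommGroup E₃] [NormedSpace ℝ E₃]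
    {M₁ M₂ M₃ : Type*} [TopologicalSpace M₁] [ChartedSpace E₁ M₁] [TopologicalSpace M₂]
    [ChartedSpace E₂ M₂] [TopologicalSpace M₃] [ChartedSpace E₃ M₃] {f : M₁ → M₂} {g : M₂ → M₃}
    (hg : MDifferentiable 𝓘(ℝ, E₂) 𝓘(ℝ, E₃) g) (hf : MDifferentiable 𝓘(ℝ, E₁) 𝓘(ℝ, E₂) f)
    (Θ : TwoForm E₃ M₃) :
    pullback (E' := E₁) (g ∘ f) Θ = pullback (E' := E₁) f (pullback (E' := E₂) g Θ) := by
  funext x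
  ext v
  simp only [pullback]
  rw [mfderiv_comp x (hg _) (hf x)]
  rfl

theorem pullback_neg {E₁ E₂ : Type*} [NormedAddCommGroup E₁] [NormedSpace ℝ E₁]
    [NormedAddCommGroup E₂] [NormedSpace ℝ E₂]
    {M₁ M₂ : Type*} [TopologicalSpace M₁] [ChartedSpace E₁ M₁] [TopologicalSpace M₂]
    [ChartedSpace E₂ M₂] (f : M₁ → M₂) (Θ : TwoForm E₂ M₂) :
    pullback (E' := E₁) f (-Θ) = -pullback (E' := E₁) f Θ := rfl

/-- Pullback of forms along a surjective submersion is injective. -/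
theorem pullback_injective_of_isSubmersion {E₁ E₂ : Type*} [NormedAddCommGroup E₁]
    [NormedSpace ℝ E₁] [NormedAddCommGroup E₂] [NormedSpace ℝ E₂]
    {M₁ M₂ : Type*} [TopologicalSpace M₁] [ChartedSpace E₁ M₁] [IsManifold 𝓘(ℝ, E₁) ∞ M₁]
    [TopologicalSpace M₂] [ChartedSpace E₂ M₂] [IsManifold 𝓘(ℝ, E₂) ∞ M₂] {f : M₁ → M₂}
    (hf : IsSubmersion 𝓘(ℝ, E₁) 𝓘(ℝ, E₂) ∞ f) (hsurj : Function.Surjective f) :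
    Function.Injective (pullback (E := E₂) (E' := E₁) f) := by
  intro Θ Θ' h
  funext y
  obtain ⟨x, rfl⟩ := hsurj y
  ext v
  -- `r` lifts tangent vectors one at a time; it need not be linear.
  choose r hr using mfderiv_surjective_of_isSubmersionAt (by simp) (hf.isSubmersionAt x)
  have hx := DFunLike.congr_fun (congrFun h x) (fun i => r (v i))
  have hv : (⇑(mfderiv 𝓘(ℝ, E₁) 𝓘(ℝ, E₂) f x) ∘ fun i => r (v i)) = v := funext fun i => hr (v i)
  have hx' : Θ (f x) (⇑(mfderiv 𝓘(ℝ, E₁) 𝓘(ℝ, E₂) f x) ∘ fun i => r (v i)) =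
    Θ' (f x) (⇑(mfderiv 𝓘(ℝ, E₁) 𝓘(ℝ, E₂) f x) ∘ fun i => r (v i)) := hx
  rwa [hv] at hx'

/-- The map induced by an anti-symplectic involution leaving the moment map invariant is an
anti-symplectic involution of the reduction. -/
theorem isAntisymplecticInvolution_inducedMap [IsManifold 𝓘(ℝ, EZ) ∞ (LevelSet Φ μ)]
    [IsManifold 𝓘(ℝ, ER) ∞ (Reduction T Φ μ)]
    (hσ : IsAntisymplecticInvolution Ω σ) (hσT : AntiCommutes T σ)
    (hinv : ∀ x, Φ (σ x) = Φ x)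
    (hincl : IsSmoothEmbedding 𝓘(ℝ, EZ) 𝓘(ℝ, E) ∞ (incl Φ μ))
    (hproj : IsSubmersion 𝓘(ℝ, EZ) 𝓘(ℝ, ER) ∞ (proj T Φ μ))
    {Ωred : TwoForm ER (Reduction T Φ μ)}
    (hΩred : pullback (E' := EZ) (proj T Φ μ) Ωred = pullback (E' := EZ) (incl Φ μ) Ω) :
    IsAntisymplecticInvolution Ωred (inducedMap hσT hinv μ) := by
  have hsurj : Function.Surjective (proj T Φ μ) := Quotient.mk_surjective
  have hlevel := contMDiff_levelMap hincl hσ.smooth hinv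
  have hcomm : inducedMap hσT hinv μ ∘ proj T Φ μ = proj T Φ μ ∘ levelMap hinv μ := rfl
  have hcomm' : incl Φ μ ∘ levelMap hinv μ = σ ∘ incl Φ μ := rfl
  have hsmooth : ContMDiff 𝓘(ℝ, ER) 𝓘(ℝ, ER) ∞ (inducedMap hσT hinv μ) :=
    contMDiff_of_comp_isSubmersion hproj hsurj (hcomm ▸ hproj.contMDiff.comp hlevel)
  have hd : (∞ : WithTop ℕ∞) ≠ 0 := by simp
  refine ⟨hsmooth, fun y => ?_, pullback_injective_of_isSubmersion hproj hsurj ?_⟩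
  · obtain ⟨z, rfl⟩ := hsurj y
    exact congrArg (proj T Φ μ) (Subtype.ext (hσ.involutive z.1))
  -- With `τ` the restriction of `σ` to the level set: `π^* σ_red^* Ωred = τ^* π^* Ωred = τ^* i^* Ω
  -- = i^* σ^* Ω = -i^* Ω = π^* (-Ωred)`.
  · rw [← pullback_comp_apply (hsmooth.mdifferentiable hd) (hproj.contMDiff.mdifferentiable hd),
      hcomm, pullback_comp_apply (hproj.contMDiff.mdifferentiable hd) (hlevel.mdifferentiable hd),
      hΩred, ← pullback_comp_apply (hincl.contMDiff.mdifferentiable hd)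
        (hlevel.mdifferentiable hd), hcomm',
      pullback_comp_apply (hσ.smooth.mdifferentiable hd) (hincl.contMDiff.mdifferentiable hd),
      hσ.pullback_eq, pullback_neg, pullback_neg, hΩred]

end Reduction
end RealReduction

theorem mainTheorem4
    -- a compact torus `T`, i.e. a compact connected abelian Lie group
    {F : Type*} [NormedAddCommGroup F] [NormedSpace ℝ F] [FiniteDimensional ℝ F]
    {T : Type*} [TopologicalSpace T] [ChartedSpace F T] [CommGroup T] [LieGroup 𝓘(ℝ, F) ∞ T]
    [CompactSpace T] [ConnectedSpace T] [T2Space T]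
    -- a compact connected symplectic manifold `(M, Ω)`
    {E : Type*} [NormedAddCommGroup E] [NormedSpace ℝ E] [FiniteDimensional ℝ E]
    {M : Type*} [TopologicalSpace M] [ChartedSpace E M] [IsManifold 𝓘(ℝ, E) ∞ M]
    [CompactSpace M] [ConnectedSpace M] [T2Space M]
    (Ω : RealReduction.TwoForm E M) (hΩ : RealReduction.IsSymplecticForm Ω)
    -- a Hamiltonian action of `T` on `M` with moment map `Φ`
    [MulAction T M] [ContMDiffSMul 𝓘(ℝ, F) 𝓘(ℝ, E) ∞ T M]
    (Φ : M → RealReduction.LieDual F) (hΦ : RealReduction.IsHamiltonianWith T Ω Φ)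
    -- an anti-symplectic involution `σ` that anti-commutes with the action
    (σ : M → M) (hσ : RealReduction.IsAntisymplecticInvolution Ω σ)
    (hσT : RealReduction.AntiCommutes T σ)
    -- a regular value `μ` such that `T` acts freely on `Φ⁻¹(μ)`
    (μ : RealReduction.LieDual F) (hμ : RealReduction.IsRegularValue E Φ μ)
    (hfree : ∀ x : M, Φ x = μ → ∀ t : T, t • x = x → t = 1)
    -- the level set `Φ⁻¹(μ)` as an embedded submanifold of `M`
    {EZ : Type*} [NormedAddCommGroup EZ] [NormedSpace ℝ EZ] [FiniteDimensional ℝ EZ]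
    [ChartedSpace EZ (RealReduction.LevelSet Φ μ)]
    [IsManifold 𝓘(ℝ, EZ) ∞ (RealReduction.LevelSet Φ μ)]
    (hincl : Manifold.IsSmoothEmbedding 𝓘(ℝ, EZ) 𝓘(ℝ, E) ∞ (RealReduction.incl Φ μ))
    -- the smooth structure of `M//T(μ)`, for which `π` is a submersion
    {ER : Type*} [NormedAddCommGroup ER] [NormedSpace ℝ ER] [FiniteDimensional ℝ ER]
    [ChartedSpace ER (RealReduction.Reduction T Φ μ)]
    [IsManifold 𝓘(ℝ, ER) ∞ (RealReduction.Reduction T Φ μ)]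
    (hproj : Manifold.IsSubmersion 𝓘(ℝ, EZ) 𝓘(ℝ, ER) ∞ (RealReduction.proj T Φ μ))
    -- the reduced form `Ωred`, determined by `π^* Ωred = i^* Ω`
    (Ωred : RealReduction.TwoForm ER (RealReduction.Reduction T Φ μ))
    (hΩred : RealReduction.pullback (E' := EZ) (RealReduction.proj T Φ μ) Ωred =
      RealReduction.pullback (E' := EZ) (RealReduction.incl Φ μ) Ω) :
    -- `Φ` is `σ`-invariant, and the induced map `σ_red` is an anti-symplectic involution
    ∃ hinv : ∀ x, Φ (σ x) = Φ x,
      RealReduction.IsAntisymplecticInvolution Ωred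
        (RealReduction.inducedMap hσT hinv μ) := by
  have hinv := RealReduction.momentMap_invariant hΦ hσ hσT
  exact ⟨hinv, RealReduction.isAntisymplecticInvolution_inducedMap hσ hσT hinv hincl hproj hΩred⟩
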